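/- Let $Y \hookrightarrow (\mathbb{C}^2,0)$ be a plane curve singularity, that is, a reduced formal germ of dimension one, given by a radical ideal $I_Y \subset \mathbb{C}[[x,y]]$ whose quotient ring $\mathbb{C}[[x,y]]/I_Y$ has Krull dimension $1$. Assume that no branch (irreducible component) of $Y$ is contained in the union of the coordinate axes $Z(x)$ and $Z(y)$, that is, no minimal prime over $I_Y$ contains $x$ or $y$. For a series $f=\sum f_{\alpha,\beta}\,x^\alpha y^\beta$, let its Newton polygon $\mathcal{N}(f)$ be the convex hull in $\mathbb{R}^2$ of $\{(\alpha,\beta) : f_{\alpha,\beta}\neq 0\}+\mathbb{R}_{\geq 0}^2$. Let the local tropicalization of $Y$ be the closure in $\mathbb{R}^2$ of the union of the rays $\mathbb{R}_{\geq 0}\,(p,q)$, where $(p,q)=(\operatorname{ord}_t x(t),\operatorname{ord}_t y(t))$ for some formal arc $t\mapsto (x(t),y(t))$ with $x(t),y(t)\in t\,\mathbb{C}[[t]]\smallsetminus\{0\}$ which is contained in $Y$, i.e. $g(x(t),y(t))=0$ for every $g\in I_Y$. Then $Y$ has a well-defined Newton polygon $\mathcal{N}(Y)$: the ideal $I_Y$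 is principal, and all its generators $f$ have the same Newton polygon $\mathcal{N}(Y):=\mathcal{N}(f)$. Moreover, the local tropicalization of $Y$ is the union of the rays contained in $\mathbb{R}_{\geq 0}^2$ which are orthogonal to the compact edges (that is, the compact one-dimensional faces) of $\mathcal{N}(Y)$. -/

import Mathlib

open scoped Pointwise

/-- A formal germ `Y ↪ (ℂ², 0)` is given by its defining ideal `I` in `ℂ⟦x, y⟧` (with `x = X 0`,
`y = X 1`). It is a plane curve singularity if it is reduced and of dimension one. -/
structure IsPlaneCurveSingularity (I : Ideal (MvPowerSeries (Fin 2) ℂ)) : Prop where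
  isRadical : I.IsRadical
  ringKrullDim_eq : ringKrullDim (MvPowerSeries (Fin 2) ℂ ⧸ I) = 1

/-- The branches of the germ defined by a radical ideal `I` correspond to the minimal primes `P`
over `I`; such a branch lies in `Z(x) ∪ Z(y)` if and only if `x ∈ P` or `y ∈ P`. -/
def NoBranchInAxes (I : Ideal (MvPowerSeries (Fin 2) ℂ)) : Prop :=
  ∀ P ∈ I.minimalPrimes, ∀ i, (MvPowerSeries.X i : MvPowerSeries (Fin 2) ℂ) ∉ P

/-- The support of a series, inside the plane of exponents. -/
def seriesSupport (f : MvPowerSeries (Fin 2) ℂ) : Set (Fin 2 → ℝ) :=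
  {v | ∃ m : Fin 2 →₀ ℕ, MvPowerSeries.coeff m f ≠ 0 ∧ ∀ i, v i = (m i : ℝ)}

/-- The (local) Newton polygon of a series: the convex hull of the Minkowski sum of its support
and the non-negative quadrant. -/
def newtonPolygon (f : MvPowerSeries (Fin 2) ℂ) : Set (Fin 2 → ℝ) :=
  convexHull ℝ (seriesSupport f + {v : Fin 2 → ℝ | ∀ i, 0 ≤ v i})

/-- `N` is the Newton polygon of the germ defined by `I`: the germ is the zero locus of one series,
and `N` is the Newton polygon of every series defining it. -/
def IsNewtonPolygonOf (I : Ideal (MvPowerSeries (Fin 2) ℂ)) (N : Set (Fin 2 → ℝ)) : Prop :=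
  (∃ f, I = Ideal.span {f}) ∧ ∀ f, I = Ideal.span {f} → newtonPolygon f = N

/-- `E` is a compact edge of the polygon `N`: a compact face of dimension one, faces being the
loci where linear forms attain their extremum on `N`. -/
structure IsCompactEdge (N E : Set (Fin 2 → ℝ)) : Prop where
  isExposed : IsExposed ℝ N E
  isCompact : IsCompact E
  finrank_eq : Module.finrank ℝ (vectorSpan ℝ E) = 1

/-- The ray orthogonal to an edge `E`, inside the non-negative quadrant of the weight plane. -/
def orthogonalRay (E : Set (Fin 2 → ℝ)) : Set (Fin 2 → ℝ) :=
  {w | (∀ i, 0 ≤ w i) ∧ ∀ a ∈ E, ∀ b ∈ E, w ⬝ᵥ (a - b) = 0}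

/-- `t ↦ (γ₀(t), γ₁(t))` is a formal arc of `(ℂ², 0)` contained in the germ defined by `I`. -/
structure IsArcIn (I : Ideal (MvPowerSeries (Fin 2) ℂ)) (γ : Fin 2 → PowerSeries ℂ) : Prop where
  constantCoeff_eq_zero : ∀ i, PowerSeries.constantCoeff (γ i) = 0
  subst_eq_zero : ∀ g ∈ I, MvPowerSeries.subst γ g = 0

/-- An arc is interior if it is not contained in the union of the coordinate axes. -/
def IsInteriorArc (γ : Fin 2 → PowerSeries ℂ) : Prop :=
  ∀ i, γ i ≠ 0

/-- The vector of initial exponents of an interior arc. -/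
noncomputable def weightVector (γ : Fin 2 → PowerSeries ℂ) : Fin 2 → ℝ :=
  fun i => ((γ i).order.toNat : ℝ)

/-- The weight vectors of the interior arcs contained in the germ defined by `I`. -/
def arcwiseWeightVectors (I : Ideal (MvPowerSeries (Fin 2) ℂ)) : Set (Fin 2 → ℝ) :=
  {w | ∃ γ, IsArcIn I γ ∧ IsInteriorArc γ ∧ w = weightVector γ}

/-- The local tropicalization: the closure of the union of the rays generated by the arcwise
weight vectors. -/
def localTropicalization (I : Ideal (MvPowerSeries (Fin 2) ℂ)) : Set (Fin 2 → ℝ) :=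
  closure (⋃ w ∈ arcwiseWeightVectors I, {v | ∃ c : ℝ, 0 ≤ c ∧ v = c • w})

/-! Principality: since no branch lies in `x = 0`, `x` is regular modulo `I`. The image of `I` in
`ℂ⟦y⟧` is principal, and Nakayama lifts a generator to one of `I`. Two generators divide each other,
and multiplying by a series cannot enlarge the Newton polygon.

Tropicalization, easy half: if `f` vanishes on an arc of weight `w`, the terms of least `w`-weight
must cancel, so the least weight is attained at two exponents at least, and `w` is orthogonal to a
compact edge (`exists_ne_of_subst_eq_zero`). There are finitely many compact edges, so the union of
their rays is already closed.

Hard half: an edge has a positive integral normal `w`. Substituting `x = t ^ w 0`, `y = s * t ^ w 1`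
and dividing by the largest power of `t` gives `F` in `k[s]⟦t⟧`, whose restriction to `t = 0` has
two nonzero coefficients, hence a root `c ≠ 0`. A formal parametrization of `F = 0` through `(t, s)
= (0, c)` then yields an arc of weight proportional to `w` (`exists_arc`). The parametrization comes
from normalization: a suitable quotient of `k[s]⟦t⟧` is finite over `k⟦t⟧`, its integral closure is
Dedekind with residue field `k`, and expanding in a uniformizer maps it into power series. -/

namespace PlaneSeries

/-! ### Two-variable series: restriction to a line, principal ideals, substitutions -/

variable {k : Type*} [Field k]

theorem hasSubst_zero_X :
    MvPowerSeries.HasSubst (S := k) (![0, PowerSeries.X] : Fin 2 → PowerSeries k) :=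
  MvPowerSeries.hasSubst_of_constantCoeff_zero fun i => by
    fin_cases i
    · simp
    · exact PowerSeries.constantCoeff_X

/-- Restriction of a series in two variables to the line where the first variable vanishes. -/
noncomputable def restrict : MvPowerSeries (Fin 2) k →ₐ[k] PowerSeries k :=
  MvPowerSeries.substAlgHom hasSubst_zero_X

theorem finsupp_fin_two_ext {m m' : Fin 2 →₀ ℕ} (h0 : m 0 = m' 0) (h1 : m 1 = m' 1) : m = m' := by
  ext i
  fin_cases i <;> assumption

theorem coeff_subst_fin_two {S : Type*} [CommRing S] [Algebra k S] {a : Fin 2 → PowerSeries S}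
    (ha : MvPowerSeries.HasSubst a) (f : MvPowerSeries (Fin 2) k) (n : ℕ) :
    PowerSeries.coeff n (MvPowerSeries.subst a f : PowerSeries S) =
      ∑ᶠ m : Fin 2 →₀ ℕ, MvPowerSeries.coeff m f • PowerSeries.coeff n (a 0 ^ m 0 * a 1 ^ m 1) := by
  rw [PowerSeries.coeff, MvPowerSeries.coeff_subst ha]
  refine finsum_congr fun m => ?_
  rw [Finsupp.prod_fintype _ _ (fun _ => pow_zero _), Fin.prod_univ_two]

theorem coeff_restrict (f : MvPowerSeries (Fin 2) k) (n : ℕ) :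
    PowerSeries.coeff n (restrict f) = MvPowerSeries.coeff (Finsupp.single 1 n) f := by
  rw [restrict, MvPowerSeries.coe_substAlgHom, coeff_subst_fin_two hasSubst_zero_X,
    finsum_eq_single _ (Finsupp.single 1 n)]
  · simp [PowerSeries.coeff_X_pow]
  · intro m hm
    by_cases h0 : m 0 = 0
    · have : n ≠ m 1 := by
        rintro rfl
        exact hm (finsupp_fin_two_ext (by simp [h0]) (by simp))
      simp [h0, PowerSeries.coeff_X_pow, this]
    · simp [h0]

theorem restrict_X_zero : restrict (MvPowerSeries.X 0 : MvPowerSeries (Fin 2) k) = 0 := by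
  exact (MvPowerSeries.substAlgHom_X hasSubst_zero_X _).trans (by simp)

theorem restrict_X_one :
    restrict (MvPowerSeries.X 1 : MvPowerSeries (Fin 2) k) = PowerSeries.X := by
  exact (MvPowerSeries.substAlgHom_X hasSubst_zero_X _).trans (by simp)

theorem restrict_eq_zero_iff {f : MvPowerSeries (Fin 2) k} :
    restrict f = 0 ↔ MvPowerSeries.X 0 ∣ f := by
  constructor
  · intro h
    rw [MvPowerSeries.X_dvd_iff]
    intro m hm
    have := coeff_restrict f (m 1)
    rw [h, map_zero] at this
    rw [this, finsupp_fin_two_ext (m := m) (m' := Finsupp.single 1 (m 1)) (by simp [hm]) (by simp)]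
    simp
  · rintro ⟨g, rfl⟩
    rw [map_mul, restrict_X_zero, zero_mul]

/-- A section of `restrict`. -/
noncomputable def extend : PowerSeries k →ₐ[k] MvPowerSeries (Fin 2) k :=
  PowerSeries.substAlgHom (PowerSeries.HasSubst.X (1 : Fin 2))

theorem restrict_extend (g : PowerSeries k) : restrict (extend g) = g := by
  ext n
  rw [coeff_restrict, extend, PowerSeries.coe_substAlgHom, PowerSeries.coeff_subst_single]
  simp

theorem X_zero_dvd_sub_extend (f : MvPowerSeries (Fin 2) k) :
    MvPowerSeries.X 0 ∣ f - extend (restrict f) := by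
  rw [← restrict_eq_zero_iff, map_sub, restrict_extend, sub_self]

theorem extend_X : extend (PowerSeries.X : PowerSeries k) = MvPowerSeries.X 1 := by
  rw [extend, PowerSeries.substAlgHom_X]

/-- An ideal modulo which the first variable is regular is principal. -/
theorem exists_eq_span_singleton {I : Ideal (MvPowerSeries (Fin 2) k)}
    (hI : ∀ g, MvPowerSeries.X 0 * g ∈ I → g ∈ I) : ∃ f, I = Ideal.span {f} := by
  have hp := (IsPrincipalIdealRing.principal (I.map (restrict (k := k)).toRingHom)).principal
  obtain ⟨r, hr⟩ := hp
  have hsurj : Function.Surjective (restrict (k := k)).toRingHom := fun g =>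
    ⟨extend g, restrict_extend g⟩
  have hmem : r ∈ I.map (restrict (k := k)).toRingHom := by
    rw [hr]; exact Submodule.mem_span_singleton_self r
  obtain ⟨f, hf, hfr⟩ := (Ideal.mem_map_iff_of_surjective _ hsurj).1 hmem
  refine ⟨f, le_antisymm ?_ ((Ideal.span_singleton_le_iff_mem _).2 hf)⟩
  -- Nakayama, from `I ≤ (f) + x I`: subtracting a multiple of `f` from `g ∈ I` leaves some `x * h`,
  -- and `h ∈ I` by regularity.
  refine Submodule.le_of_le_smul_of_le_jacobson_bot (I := Ideal.span {MvPowerSeries.X 0})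
    (IsNoetherian.noetherian I) ?_ ?_
  · rw [IsLocalRing.jacobson_eq_maximalIdeal _ bot_ne_top, Ideal.span_singleton_le_iff_mem,
      IsLocalRing.mem_maximalIdeal, mem_nonunits_iff, MvPowerSeries.isUnit_iff_constantCoeff]
    simp
  · intro g hg
    have hgr : restrict g ∈ I.map (restrict (k := k)).toRingHom := Ideal.mem_map_of_mem _ hg
    rw [hr] at hgr
    obtain ⟨a, ha⟩ := Ideal.mem_span_singleton'.1 hgr
    have : restrict (g - extend a * f) = 0 := by
      have hfr' : restrict f = r := hfr
      rw [map_sub, map_mul, restrict_extend, hfr', ha, sub_self]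
    obtain ⟨h, hh⟩ := restrict_eq_zero_iff.1 this
    have hhI : h ∈ I := hI h (hh ▸ I.sub_mem hg (I.mul_mem_left _ hf))
    rw [show g = extend a * f + MvPowerSeries.X 0 * h by rw [← hh]; ring]
    refine Submodule.add_mem_sup (Ideal.mul_mem_left _ _ (Ideal.mem_span_singleton_self f)) ?_
    exact Ideal.mul_mem_mul (Ideal.mem_span_singleton_self _) hhI

/-- The ideal `(x)` is a nonzero prime, the kernel of `restrict`, and is not maximal because it
misses `y`. This rules out `I = ⊥`. -/
theorem not_krullDimLE_one : ¬ Ring.KrullDimLE 1 (MvPowerSeries (Fin 2) k) := by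
  intro h
  have hker : RingHom.ker (restrict (k := k)).toRingHom = Ideal.span {MvPowerSeries.X 0} := by
    ext g
    rw [Ideal.mem_span_singleton, ← restrict_eq_zero_iff]
    rfl
  have hprime : (RingHom.ker (restrict (k := k)).toRingHom).IsPrime := RingHom.ker_isPrime _
  have hmem : (MvPowerSeries.X 0 : MvPowerSeries (Fin 2) k) ∈
      RingHom.ker (restrict (k := k)).toRingHom := restrict_X_zero
  have hne : RingHom.ker (restrict (k := k)).toRingHom ≠ ⊥ := by
    intro h0
    rw [h0, Ideal.mem_bot] at hmem
    have := congrArg (MvPowerSeries.coeff (Finsupp.single 0 1)) hmem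
    simp at this
  have hmax := Ideal.IsPrime.isMaximal_of_ne_bot hprime hne
  have hX : (MvPowerSeries.X 1 : MvPowerSeries (Fin 2) k) ∈
      RingHom.ker (restrict (k := k)).toRingHom := by
    rw [IsLocalRing.eq_maximalIdeal hmax, IsLocalRing.mem_maximalIdeal, mem_nonunits_iff,
      MvPowerSeries.isUnit_iff_constantCoeff]
    simp
  exact PowerSeries.X_ne_zero ((restrict_X_one (k := k)).symm.trans hX)

theorem exists_eq_add_X_mul_add_X_mul (f : MvPowerSeries (Fin 2) k) :
    ∃ (c : k) (g h : MvPowerSeries (Fin 2) k),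
      f = algebraMap k _ c + MvPowerSeries.X 0 * g + MvPowerSeries.X 1 * h := by
  obtain ⟨g, hg⟩ := X_zero_dvd_sub_extend f
  obtain ⟨h, hh⟩ := PowerSeries.X_dvd_iff.2
    (show PowerSeries.constantCoeff (restrict f -
      algebraMap k _ (PowerSeries.constantCoeff (restrict f))) = 0 by simp)
  refine ⟨PowerSeries.constantCoeff (restrict f), g, extend h, ?_⟩
  have := congrArg extend hh
  rw [map_sub, map_mul, extend_X, AlgHom.commutes] at this
  rw [← this, ← hg]
  ring

/-- Every homomorphism of algebras which is compatible with the maximal ideals is a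
substitution. -/
theorem algHom_eq_subst (ψ : MvPowerSeries (Fin 2) k →ₐ[k] PowerSeries k)
    (hψ : ∀ i, PowerSeries.constantCoeff (ψ (MvPowerSeries.X i)) = 0)
    (f : MvPowerSeries (Fin 2) k) :
    MvPowerSeries.subst (fun i => ψ (MvPowerSeries.X i)) f = ψ f := by
  have hs : MvPowerSeries.HasSubst (S := k) (fun i => ψ (MvPowerSeries.X i)) :=
    MvPowerSeries.hasSubst_of_constantCoeff_zero hψ
  let φ : MvPowerSeries (Fin 2) k →ₐ[k] PowerSeries k := MvPowerSeries.substAlgHom hs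
  have hφ : ∀ i, φ (MvPowerSeries.X i) = ψ (MvPowerSeries.X i) := fun i =>
    MvPowerSeries.substAlgHom_X hs i
  have key : ∀ n : ℕ, ∀ f, (PowerSeries.X : PowerSeries k) ^ n ∣ φ f - ψ f := by
    intro n
    induction n with
    | zero => simp
    | succ n ih =>
      intro f
      obtain ⟨c, g, h, rfl⟩ := exists_eq_add_X_mul_add_X_mul f
      -- The two maps agree on constants and on both variables, and the variables go to multiples of
      -- `X`; each round of the decomposition therefore gains one power of `X`.
      have : φ (algebraMap k _ c + MvPowerSeries.X 0 * g + MvPowerSeries.X 1 * h) -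
          ψ (algebraMap k _ c + MvPowerSeries.X 0 * g + MvPowerSeries.X 1 * h) =
          ψ (MvPowerSeries.X 0) * (φ g - ψ g) + ψ (MvPowerSeries.X 1) * (φ h - ψ h) := by
        simp only [map_add, map_mul, hφ, AlgHom.commutes]
        ring
      rw [this, pow_succ']
      exact dvd_add (mul_dvd_mul (PowerSeries.X_dvd_iff.2 (hψ 0)) (ih g))
        (mul_dvd_mul (PowerSeries.X_dvd_iff.2 (hψ 1)) (ih h))
  have : φ f - ψ f = 0 := by
    ext n
    exact PowerSeries.X_pow_dvd_iff.1 (key (n + 1) f) n n.lt_succ_self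
  rw [← sub_eq_zero, ← this, ← MvPowerSeries.coe_substAlgHom hs]

end PlaneSeries

/-! ### Consequences of the hypotheses on the germ; independence of the generator -/

theorem NoBranchInAxes.mem_of_X_mul_mem {I : Ideal (MvPowerSeries (Fin 2) ℂ)}
    (hax : NoBranchInAxes I) (hI : I.IsRadical) (i : Fin 2) {g : MvPowerSeries (Fin 2) ℂ}
    (h : MvPowerSeries.X i * g ∈ I) : g ∈ I := by
  rw [← hI.radical, ← Ideal.sInf_minimalPrimes, Ideal.mem_sInf]
  intro P hP
  exact (hP.1.1.mem_or_mem (hP.1.2 h)).resolve_left (hax P hP i)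

theorem IsPlaneCurveSingularity.ne_bot {I : Ideal (MvPowerSeries (Fin 2) ℂ)}
    (hY : IsPlaneCurveSingularity I) : I ≠ ⊥ := by
  rintro rfl
  refine PlaneSeries.not_krullDimLE_one (k := ℂ) ?_
  have h := hY.ringKrullDim_eq
  rw [ringKrullDim_eq_of_ringEquiv (RingEquiv.quotientBot _)] at h
  rw [Ring.krullDimLE_iff, h]
  rfl

theorem seriesSupport_mul_subset (u f : MvPowerSeries (Fin 2) ℂ) :
    seriesSupport (u * f) ⊆ seriesSupport f + {v : Fin 2 → ℝ | ∀ i, 0 ≤ v i} := by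
  classical
  rintro v ⟨m, hm, hv⟩
  rw [MvPowerSeries.coeff_mul] at hm
  obtain ⟨⟨a, b⟩, hab, hne⟩ := Finset.exists_ne_zero_of_sum_ne_zero hm
  rw [Finset.HasAntidiagonal.mem_antidiagonal] at hab
  refine ⟨fun i => (b i : ℝ), ⟨b, right_ne_zero_of_mul hne, fun _ => rfl⟩, fun i => (a i : ℝ),
    fun i => Nat.cast_nonneg _, ?_⟩
  funext i
  simp only [Pi.add_apply, hv, ← hab, Finsupp.add_apply]
  push_cast
  ring

theorem newtonPolygon_mul_subset (u f : MvPowerSeries (Fin 2) ℂ) :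
    newtonPolygon (u * f) ⊆ newtonPolygon f := by
  refine convexHull_mono ?_
  rintro _ ⟨v, hv, w, hw, rfl⟩
  obtain ⟨v', hv', w', hw', rfl⟩ := seriesSupport_mul_subset u f hv
  exact ⟨v', hv', w' + w, fun i => add_nonneg (hw' i) (hw i), (add_assoc _ _ _).symm⟩

theorem newtonPolygon_eq_of_span_eq {f g : MvPowerSeries (Fin 2) ℂ}
    (h : Ideal.span {f} = Ideal.span {g}) : newtonPolygon f = newtonPolygon g := by
  obtain ⟨u, hu⟩ := Ideal.mem_span_singleton'.1 (h ▸ Ideal.mem_span_singleton_self f)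
  obtain ⟨v, hv⟩ := Ideal.mem_span_singleton'.1 (h.symm ▸ Ideal.mem_span_singleton_self g)
  refine subset_antisymm ?_ ?_
  · rw [← hu]
    exact newtonPolygon_mul_subset u g
  · rw [← hv]
    exact newtonPolygon_mul_subset v f

/-! ### Expansion in a uniformizer -/

section Expansion

variable {k V : Type*} [Field k] [CommRing V] [Algebra k V]

/-- The pairs of an element and of a power series expanding it in terms of `π`. -/
def expansionSubalgebra (k : Type*) {V : Type*} [Field k] [CommRing V] [Algebra k V] (π : V) :
    Subalgebra k (V × PowerSeries k) where
  carrier := {z | ∀ n, ∃ p : Polynomial k,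
    π ^ n ∣ z.1 - Polynomial.aeval π p ∧ PowerSeries.X ^ n ∣ z.2 - (p : PowerSeries k)}
  mul_mem' := by
    intro y z hy hz n
    obtain ⟨p, hp, hp'⟩ := hy n
    obtain ⟨q, hq, hq'⟩ := hz n
    refine ⟨p * q, ?_, ?_⟩
    · rw [map_mul, Prod.fst_mul, show y.1 * z.1 - Polynomial.aeval π p * Polynomial.aeval π q =
        (y.1 - Polynomial.aeval π p) * z.1 + Polynomial.aeval π p * (z.1 - Polynomial.aeval π q) by
          ring]
      exact dvd_add (hp.mul_right _) (hq.mul_left _)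
    · rw [Polynomial.coe_mul, Prod.snd_mul, show y.2 * z.2 - (p : PowerSeries k) * q =
        (y.2 - p) * z.2 + p * (z.2 - q) by ring]
      exact dvd_add (hp'.mul_right _) (hq'.mul_left _)
  add_mem' := by
    intro y z hy hz n
    obtain ⟨p, hp, hp'⟩ := hy n
    obtain ⟨q, hq, hq'⟩ := hz n
    refine ⟨p + q, ?_, ?_⟩
    · rw [map_add, Prod.fst_add, add_sub_add_comm]
      exact dvd_add hp hq
    · rw [Polynomial.coe_add, Prod.snd_add, add_sub_add_comm]
      exact dvd_add hp' hq'
  algebraMap_mem' := by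
    intro c n
    refine ⟨Polynomial.C c, ?_, ?_⟩
    · simp
    · simp

/-- The digits are obtained by iterating `w`: subtract the residue `c v`, divide by `π`, repeat. -/
theorem exists_mem_expansionSubalgebra {π : V} (hsurj : ∀ v : V, ∃ c : k, π ∣ v - algebraMap k V c)
    (v : V) : ∃ a : PowerSeries k, (v, a) ∈ expansionSubalgebra k π := by
  choose c w hw using hsurj
  let a : PowerSeries k := PowerSeries.mk fun n => c (w^[n] v)
  have key : ∀ n, v - Polynomial.aeval π (PowerSeries.trunc n a) = π ^ n * w^[n] v := by
    intro n
    induction n with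
    | zero => simp
    | succ n ih =>
      rw [PowerSeries.trunc_succ, map_add, ← sub_sub, ih, Polynomial.aeval_monomial,
        PowerSeries.coeff_mk, Function.iterate_succ_apply', pow_succ, mul_assoc, ← hw]
      ring
  refine ⟨a, fun n => ⟨PowerSeries.trunc n a, key n ▸ dvd_mul_right _ _, ?_⟩⟩
  rw [PowerSeries.X_pow_dvd_iff]
  intro m hm
  rw [map_sub, Polynomial.coeff_coe, PowerSeries.coeff_trunc, if_pos hm, sub_self]

variable [IsDomain V]

/-- A polynomial in `π` divisible by `π` has zero constant term, since otherwise `π` would be a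
unit. One factor can then be cancelled on both sides; iterating gives uniqueness of expansions. -/
theorem exists_eq_X_mul_of_mem_expansionSubalgebra {π : V} (h0 : π ≠ 0) (hπ : ¬ IsUnit π)
    {a : PowerSeries k} (ha : (0, a) ∈ expansionSubalgebra k π) :
    ∃ b, a = PowerSeries.X * b ∧ (0, b) ∈ expansionSubalgebra k π := by
  have key : ∀ n, ∃ p : Polynomial k, π ^ n ∣ Polynomial.aeval π p ∧
      PowerSeries.X ^ (n + 1) ∣ a - PowerSeries.X * (p : PowerSeries k) := by
    intro n
    obtain ⟨p, hp, hp'⟩ := ha (n + 1)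
    rw [zero_sub, dvd_neg] at hp
    have hdvd : π ∣ Polynomial.aeval π p := (dvd_pow_self π n.succ_ne_zero).trans hp
    have hp0 : p.coeff 0 = 0 := by
      by_contra hne
      rw [← Polynomial.divX_mul_X_add p, map_add, map_mul, Polynomial.aeval_X, Polynomial.aeval_C,
        dvd_add_right (dvd_mul_left _ _)] at hdvd
      exact hπ (isUnit_of_dvd_unit hdvd ((Ne.isUnit hne).map (algebraMap k V)))
    have hpX : p = p.divX * Polynomial.X := by
      conv_lhs => rw [← Polynomial.divX_mul_X_add p, hp0, map_zero, add_zero]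
    refine ⟨p.divX, ?_, ?_⟩
    · rw [hpX, map_mul, Polynomial.aeval_X, pow_succ] at hp
      exact (mul_dvd_mul_iff_right h0).1 hp
    · rw [hpX, Polynomial.coe_mul, Polynomial.coe_X, mul_comm] at hp'
      exact hp'
  obtain ⟨p, -, hp⟩ := key 0
  obtain ⟨b, rfl⟩ : PowerSeries.X ∣ a := by
    rw [zero_add, pow_one] at hp
    exact (dvd_sub_left (dvd_mul_right _ _)).1 hp
  refine ⟨b, rfl, fun n => ?_⟩
  obtain ⟨p, hp, hp'⟩ := key n
  refine ⟨p, by simpa using hp, ?_⟩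
  rw [← mul_sub, pow_succ'] at hp'
  exact (mul_dvd_mul_iff_left PowerSeries.X_ne_zero).1 hp'

theorem eq_zero_of_mem_expansionSubalgebra {π : V} (h0 : π ≠ 0) (hπ : ¬ IsUnit π)
    {a : PowerSeries k} (ha : (0, a) ∈ expansionSubalgebra k π) : a = 0 := by
  have key : ∀ n : ℕ, ∀ a : PowerSeries k, (0, a) ∈ expansionSubalgebra k π →
      PowerSeries.X ^ n ∣ a := by
    intro n
    induction n with
    | zero => simp
    | succ n ih =>
      intro a ha
      obtain ⟨b, rfl, hb⟩ := exists_eq_X_mul_of_mem_expansionSubalgebra h0 hπ ha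
      rw [pow_succ']
      exact mul_dvd_mul_left _ (ih b hb)
  ext n
  exact PowerSeries.X_pow_dvd_iff.1 (key (n + 1) a ha) n n.lt_succ_self

/-- Expansion of the elements of a ring in terms of a uniformizer. -/
theorem exists_algHom_powerSeries {π : V} (h0 : π ≠ 0) (hπ : ¬ IsUnit π)
    (hsurj : ∀ v : V, ∃ c : k, π ∣ v - algebraMap k V c) :
    ∃ φ : V →ₐ[k] PowerSeries k, φ π = PowerSeries.X := by
  -- The subalgebra is the graph of the expansion map: existence and uniqueness of expansions make
  -- the first projection bijective, and compatibility with the ring operations comes for free.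
  let p : expansionSubalgebra k π →ₐ[k] V :=
    (AlgHom.fst k V (PowerSeries k)).comp (expansionSubalgebra k π).val
  have hp : Function.Bijective p := by
    constructor
    · rw [injective_iff_map_eq_zero]
      rintro ⟨⟨v, a⟩, hv⟩ (rfl : v = 0)
      rw [Subtype.ext_iff]
      exact Prod.ext rfl (eq_zero_of_mem_expansionSubalgebra h0 hπ hv)
    · intro v
      obtain ⟨a, ha⟩ := exists_mem_expansionSubalgebra hsurj v
      exact ⟨⟨(v, a), ha⟩, rfl⟩
  refine ⟨((AlgHom.snd k V (PowerSeries k)).comp (expansionSubalgebra k π).val).comp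
    (AlgEquiv.ofBijective p hp).symm.toAlgHom, ?_⟩
  have hmem : (π, PowerSeries.X) ∈ expansionSubalgebra k π := fun n =>
    ⟨Polynomial.X, by simp, by simp⟩
  have : (AlgEquiv.ofBijective p hp).symm π = ⟨(π, PowerSeries.X), hmem⟩ := by
    rw [AlgEquiv.symm_apply_eq]
    rfl
  change ((AlgEquiv.ofBijective p hp).symm π).1.2 = PowerSeries.X
  rw [this]

/-- The completion of a Dedekind domain at a maximal ideal with residue field `k ⊆ B`. -/
theorem IsDedekindDomain.exists_ringHom_powerSeries {B : Type*} [CommRing B] [IsDedekindDomain B]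
    (ι : k →+* B) (M : Ideal B) [M.IsMaximal] (hM : M ≠ ⊥) (hsurj : ∀ b, ∃ c, b - ι c ∈ M) :
    ∃ φ : B →+* PowerSeries k, Function.Injective φ ∧ (∀ c, φ (ι c) = PowerSeries.C c) ∧
      ∀ b ∈ M, PowerSeries.constantCoeff (φ b) = 0 := by
  let W := Localization.AtPrime M
  have hW : IsDiscreteValuationRing W :=
    IsLocalization.AtPrime.isDiscreteValuationRing_of_dedekind_domain B hM W
  let _ : Algebra k W := ((algebraMap B W).comp ι).toAlgebra
  obtain ⟨π, hπ⟩ := IsDiscreteValuationRing.exists_irreducible W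
  have hmax := (IsDiscreteValuationRing.irreducible_iff_uniformizer π).1 hπ
  have hdvd : ∀ w, w ∈ IsLocalRing.maximalIdeal W ↔ π ∣ w := fun w => by
    rw [hmax, Ideal.mem_span_singleton]
  have hMW : ∀ b ∈ M, π ∣ algebraMap B W b := fun b hb =>
    (hdvd _).1 ((IsLocalization.AtPrime.to_map_mem_maximal_iff W M b).2 hb)
  obtain ⟨φ, hφ⟩ := exists_algHom_powerSeries (k := k) hπ.ne_zero hπ.not_isUnit (fun v => by
    obtain ⟨x, hx⟩ := (IsLocalization.AtPrime.equivQuotMaximalIdeal M W).surjective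
      (Ideal.Quotient.mk _ v)
    obtain ⟨b, rfl⟩ := Ideal.Quotient.mk_surjective x
    obtain ⟨c, hc⟩ := hsurj b
    refine ⟨c, ?_⟩
    rw [IsLocalization.AtPrime.equivQuotMaximalIdeal_apply_mk, eq_comm,
      Ideal.Quotient.eq, hdvd] at hx
    have := dvd_add hx (hMW _ hc)
    rwa [map_sub, sub_add_sub_cancel] at this)
  have hinj : Function.Injective φ := by
    rw [injective_iff_map_eq_zero]
    intro w hw
    by_contra hne
    obtain ⟨n, u, rfl⟩ := IsDiscreteValuationRing.eq_unit_mul_pow_irreducible hne hπ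
    rw [map_mul, map_pow, hφ] at hw
    exact mul_ne_zero (u.isUnit.map φ).ne_zero (pow_ne_zero n PowerSeries.X_ne_zero) hw
  refine ⟨φ.toRingHom.comp (algebraMap B W), ?_, fun c => φ.commutes c, fun b hb => ?_⟩
  · exact hinj.comp (IsLocalization.injective W M.primeCompl_le_nonZeroDivisors)
  · rw [← PowerSeries.X_dvd_iff, ← hφ]
    exact map_dvd φ (hMW b hb)

end Expansion

/-! ### Division with remainder in `k[s]⟦t⟧` -/

section Division

variable {k : Type*} [Field k]

/-- The coefficients of the quotient of `h` by `F`. -/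
noncomputable def quotientCoeff (F h : PowerSeries (Polynomial k)) : ℕ → Polynomial k
  | n => (PowerSeries.coeff n h -
      ∑ i : Fin n, quotientCoeff F h i * PowerSeries.coeff (n - i) F) / PowerSeries.coeff 0 F
decreasing_by exact i.2

/-- Solved one power of `t` at a time: once the earlier coefficients of `q` are known, Euclidean
division in `k[s]` by the constant coefficient of `F` gives the next coefficients of `q` and `r`. -/
theorem exists_eq_mul_add (F h : PowerSeries (Polynomial k))
    (hF : PowerSeries.constantCoeff F ≠ 0) :
    ∃ q r : PowerSeries (Polynomial k), h = q * F + r ∧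
      ∀ n, (PowerSeries.coeff n r).degree < (PowerSeries.constantCoeff F).degree := by
  let q : PowerSeries (Polynomial k) := PowerSeries.mk (quotientCoeff F h)
  refine ⟨q, h - q * F, by ring, fun n => ?_⟩
  have hsum : ∑ i ∈ Finset.range n, PowerSeries.coeff i q * PowerSeries.coeff (n - i) F =
      ∑ i : Fin n, quotientCoeff F h i * PowerSeries.coeff (n - i) F := by
    rw [Finset.sum_range]
    simp only [q, PowerSeries.coeff_mk]
  rw [map_sub, PowerSeries.coeff_mul,
    Finset.Nat.sum_antidiagonal_eq_sum_range_succ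
      (fun i j => PowerSeries.coeff i q * PowerSeries.coeff j F),
    Finset.sum_range_succ, ← sub_sub, Nat.sub_self, PowerSeries.coeff_mk, hsum, quotientCoeff,
    PowerSeries.coeff_zero_eq_constantCoeff_apply, mul_comm, ← EuclideanDomain.mod_eq_sub_mul_div]
  exact EuclideanDomain.mod_lt _ hF

end Division

/-! ### Formal parametrization of curves -/

section Parametrization

variable {k : Type*} [Field k]

/-- Modulo `F` every series equals its remainder, whose coefficients have bounded degree in `s`;
regrouped by powers of `s`, it is a `k⟦t⟧`-combination of `1, s, …, s ^ (d - 1)`. -/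
theorem finite_quotient_span_singleton (F : PowerSeries (Polynomial k))
    (hF : PowerSeries.constantCoeff F ≠ 0) (P : Ideal (PowerSeries (Polynomial k))) (hP : F ∈ P) :
    Module.Finite (PowerSeries k) (PowerSeries (Polynomial k) ⧸ P) := by
  let d := (PowerSeries.constantCoeff F).natDegree
  let v : Fin d → PowerSeries (Polynomial k) ⧸ P := fun i =>
    Ideal.Quotient.mk P (PowerSeries.C (Polynomial.X ^ (i : ℕ)))
  refine Module.Finite.of_surjective (Fintype.linearCombination (PowerSeries k) v) fun x => ?_
  obtain ⟨h, rfl⟩ := Ideal.Quotient.mk_surjective x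
  obtain ⟨q, r, rfl, hr⟩ := exists_eq_mul_add F h hF
  let a : Fin d → PowerSeries k := fun i => PowerSeries.mk fun n => (PowerSeries.coeff n r).coeff i
  have hsum : r = ∑ i : Fin d,
      PowerSeries.map Polynomial.C (a i) * PowerSeries.C (Polynomial.X ^ (i : ℕ)) := by
    refine PowerSeries.ext fun n => ?_
    simp only [map_sum, PowerSeries.coeff_mul_C, PowerSeries.coeff_map, a, PowerSeries.coeff_mk]
    rw [Fin.sum_univ_eq_sum_range
      (fun i => Polynomial.C ((PowerSeries.coeff n r).coeff i) * Polynomial.X ^ i)]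
    by_cases h0 : PowerSeries.coeff n r = 0
    · simp [h0]
    · exact Polynomial.as_sum_range_C_mul_X_pow' _ (Polynomial.natDegree_lt_natDegree h0 (hr n))
  refine ⟨a, ?_⟩
  rw [Fintype.linearCombination_apply, map_add, map_mul, Ideal.Quotient.eq_zero_iff_mem.2 hP,
    mul_zero, zero_add]
  conv_rhs => rw [hsum, map_sum]
  refine Finset.sum_congr rfl fun i _ => ?_
  rw [map_mul]
  exact Algebra.smul_def (a i) (v i)

/-- As `t` is prime and does not divide `F`, the factor `t ^ n` cancels; at `(t, s) = (0, c)` the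
multiple of `F` vanishes but `u` does not. -/
theorem X_pow_mul_notMem_span_singleton {F : PowerSeries (Polynomial k)} {c : k}
    (hF : PowerSeries.constantCoeff F ≠ 0) (hc : (PowerSeries.constantCoeff F).eval c = 0)
    {n : ℕ} {u : PowerSeries (Polynomial k)} (hu : (PowerSeries.constantCoeff u).eval c ≠ 0) :
    PowerSeries.X ^ n * u ∉ Ideal.span {F} := by
  intro h
  obtain ⟨v, hv⟩ := Ideal.mem_span_singleton.1 h
  have hXF : ¬ PowerSeries.X ∣ F := by rwa [PowerSeries.X_dvd_iff]
  obtain ⟨v', rfl⟩ : PowerSeries.X ^ n ∣ v :=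
    PowerSeries.X_prime.pow_dvd_of_dvd_mul_left n hXF ⟨u, hv.symm⟩
  rw [mul_left_comm] at hv
  rw [mul_left_cancel₀ (pow_ne_zero n PowerSeries.X_ne_zero) hv, map_mul, Polynomial.eval_mul, hc,
    zero_mul] at hu
  exact hu rfl

variable [IsAlgClosed k] [CharZero k]

/-- Normalize `D` inside its fraction field, which is separable over that of `k⟦t⟧` in
characteristic zero, choose a maximal ideal over `m`, and expand there in a uniformizer. -/
theorem exists_ringHom_powerSeries_of_finite {D : Type*} [CommRing D] [IsDomain D]
    [Algebra (PowerSeries k) D] [FaithfulSMul (PowerSeries k) D] [Module.Finite (PowerSeries k) D]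
    (m : Ideal D) [m.IsMaximal] (hX : algebraMap (PowerSeries k) D PowerSeries.X ∈ m) :
    ∃ φ : D →+* PowerSeries k, Function.Injective φ ∧
      (∀ c, φ (algebraMap (PowerSeries k) D (PowerSeries.C c)) = PowerSeries.C c) ∧
      ∀ b ∈ m, PowerSeries.constantCoeff (φ b) = 0 := by
  let O := PowerSeries k
  let L := FractionRing D
  have : FaithfulSMul O L := FaithfulSMul.trans O D L
  let _ : Algebra (FractionRing O) L := FractionRing.liftAlgebra O L
  have : IsScalarTower O (FractionRing O) L := FractionRing.isScalarTower_liftAlgebra O L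
  have : Algebra.IsIntegral O D := inferInstance
  have : FiniteDimensional (FractionRing O) L := inferInstance
  have : CharZero O := charZero_of_injective_ringHom (PowerSeries.C_injective (R := k))
  have : Algebra.IsSeparable (FractionRing O) L := Algebra.IsAlgebraic.isSeparable_of_perfectField
  let B := integralClosure O L
  have : IsDedekindDomain B := integralClosure.isDedekindDomain O (FractionRing O) L
  let j : D →ₐ[O] B := (IsScalarTower.toAlgHom O D L).codRestrict (integralClosure O L)
    fun x => (Algebra.IsIntegral.isIntegral x).map (IsScalarTower.toAlgHom O D L)
  have hj : Function.Injective j := fun x y h =>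
    IsFractionRing.injective D L (congrArg Subtype.val h)
  let _ : Algebra D B := j.toRingHom.toAlgebra
  have : IsScalarTower O D B := IsScalarTower.of_algebraMap_eq fun x => (j.commutes x).symm
  have : Algebra.IsIntegral D B := Algebra.IsIntegral.tower_top O
  obtain ⟨M, hM, hMm⟩ := Ideal.exists_ideal_over_maximal_of_isIntegral (S := B) m (by
    rw [(RingHom.injective_iff_ker_eq_bot (algebraMap D B)).1 hj]
    exact bot_le)
  have hmM : ∀ x, x ∈ m ↔ j x ∈ M := fun x => by rw [← hMm]; rfl
  have hXM : algebraMap O B PowerSeries.X ∈ M := by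
    rw [← j.commutes]
    exact (hmM _).1 hX
  have hX0 : algebraMap O B PowerSeries.X ≠ 0 := by
    rw [← j.commutes]
    exact (map_ne_zero_iff j hj).2 ((map_ne_zero_iff _
      (FaithfulSMul.algebraMap_injective O D)).2 PowerSeries.X_ne_zero)
  let ι : k →+* B := (algebraMap O B).comp PowerSeries.C
  -- The residue field at `M` is integral over `k⟦t⟧`, on which it sees only constant terms because
  -- `t ∈ M`. It is thus integral over the algebraically closed `k`, hence equal to it.
  have hι : Function.Surjective ((Ideal.Quotient.mk M).comp ι) := by
    refine (IsAlgClosed.ringHom_bijective_of_isIntegral _ ?_).2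
    refine RingHom.IsIntegral.tower_top (PowerSeries.constantCoeff (R := k)) _ ?_
    have : ((Ideal.Quotient.mk M).comp ι).comp (PowerSeries.constantCoeff (R := k)) =
        (Ideal.Quotient.mk M).comp (algebraMap O B) := by
      refine RingHom.ext fun g => ?_
      obtain ⟨h, hh⟩ := PowerSeries.X_dvd_iff.2 (show PowerSeries.constantCoeff
        (PowerSeries.C (PowerSeries.constantCoeff g) - g) = 0 by simp)
      refine Ideal.Quotient.eq.2 ?_
      change algebraMap O B (PowerSeries.C (PowerSeries.constantCoeff g)) - algebraMap O B g ∈ M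
      rw [← map_sub, hh, map_mul]
      exact M.mul_mem_right _ hXM
    rw [this]
    refine RingHom.IsIntegral.trans _ _ (algebraMap_isIntegral_iff.2 inferInstance) ?_
    exact RingHom.isIntegral_of_surjective _ Ideal.Quotient.mk_surjective
  obtain ⟨φ, hφ, hφc, hφM⟩ := IsDedekindDomain.exists_ringHom_powerSeries ι M
    (fun h => hX0 (by rwa [h] at hXM)) fun b => by
      obtain ⟨c, hc⟩ := hι (Ideal.Quotient.mk M b)
      exact ⟨c, Ideal.Quotient.eq.1 hc.symm⟩
  refine ⟨φ.comp j.toRingHom, hφ.comp hj, fun c => ?_, fun b hb => hφM _ ((hmM b).1 hb)⟩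
  exact (congrArg φ (j.commutes (PowerSeries.C c))).trans (hφc c)

/-- A curve in the `(t, s)`-plane which does not contain the line `t = 0` has a formal
parametrization through each of its points of that line, along which `t` is not constant. -/
theorem exists_parametrization {F : PowerSeries (Polynomial k)} {c : k}
    (hF : PowerSeries.constantCoeff F ≠ 0) (hc : (PowerSeries.constantCoeff F).eval c = 0) :
    ∃ ψ : PowerSeries (Polynomial k) →+* PowerSeries k, ψ F = 0 ∧
      (∀ a, ψ (PowerSeries.C (Polynomial.C a)) = PowerSeries.C a) ∧
      ψ PowerSeries.X ≠ 0 ∧ PowerSeries.constantCoeff (ψ PowerSeries.X) = 0 ∧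
      PowerSeries.constantCoeff (ψ (PowerSeries.C Polynomial.X)) = c := by
  let ε : PowerSeries (Polynomial k) →+* k :=
    (Polynomial.evalRingHom c).comp PowerSeries.constantCoeff
  -- A prime avoiding `S` does not contain `t` and consists of series vanishing at `(0, c)`: it
  -- defines a component of `F = 0` through that point, other than `t = 0`.
  let S : Submonoid (PowerSeries (Polynomial k)) :=
    Submonoid.powers PowerSeries.X ⊔ (Submonoid.comap ε (nonZeroDivisors k))
  have hS : ∀ n u, ε u ≠ 0 → PowerSeries.X ^ n * u ∈ S := fun n u hu =>
    Submonoid.mul_mem_sup ⟨n, rfl⟩ (mem_nonZeroDivisors_iff_ne_zero.2 hu)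
  obtain ⟨P, hP, hFP, hPS⟩ := Ideal.exists_le_prime_disjoint (Ideal.span {F}) S (by
    rw [Set.disjoint_left]
    rintro x hx hxS
    obtain ⟨_, ⟨n, rfl⟩, u, hu, rfl⟩ := Submonoid.mem_sup.1 hxS
    exact X_pow_mul_notMem_span_singleton hF hc (mem_nonZeroDivisors_iff_ne_zero.1 hu) hx)
  rw [Ideal.span_singleton_le_iff_mem] at hFP
  rw [Set.disjoint_left] at hPS
  have hXP : (PowerSeries.X : PowerSeries (Polynomial k)) ∉ P := fun h =>
    hPS h (by simpa using hS 1 1 (by simp))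
  have hPε : ∀ a ∈ P, ε a = 0 := fun a ha => by
    by_contra hne
    exact hPS ha (by simpa using hS 0 a hne)
  let D := PowerSeries (Polynomial k) ⧸ P
  have : Module.Finite (PowerSeries k) D := finite_quotient_span_singleton F hF P hFP
  have hinj : Function.Injective (algebraMap (PowerSeries k) D) := by
    rw [injective_iff_map_eq_zero]
    intro g hg
    by_contra hne
    have hg' : PowerSeries.map Polynomial.C g ∈ P := Ideal.Quotient.eq_zero_iff_mem.1 hg
    rw [← PowerSeries.X_pow_order_mul_divXPowOrder (f := g), map_mul, map_pow,
      PowerSeries.map_X] at hg'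
    refine hPS hg' (hS _ _ ?_)
    change Polynomial.eval c (PowerSeries.constantCoeff _) ≠ 0
    rw [← PowerSeries.coeff_zero_eq_constantCoeff_apply, PowerSeries.coeff_map, Polynomial.eval_C,
      PowerSeries.coeff_zero_eq_constantCoeff_apply]
    exact mt PowerSeries.constantCoeff_divXPowOrder_eq_zero_iff.1 hne
  have : FaithfulSMul (PowerSeries k) D := (faithfulSMul_iff_algebraMap_injective _ _).2 hinj
  let ε' : D →+* k := Ideal.Quotient.lift P ε hPε
  have hε' : Function.Surjective ε' := fun a =>
    ⟨Ideal.Quotient.mk P (PowerSeries.C (Polynomial.C a)), by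
      rw [Ideal.Quotient.lift_mk]; simp [ε]⟩
  have hmax : (RingHom.ker ε').IsMaximal := RingHom.ker_isMaximal_of_surjective ε' hε'
  have hXD : algebraMap (PowerSeries k) D PowerSeries.X = Ideal.Quotient.mk P PowerSeries.X := by
    change Ideal.Quotient.mk P (PowerSeries.map Polynomial.C PowerSeries.X) = _
    rw [PowerSeries.map_X]
  have hCD : ∀ a, algebraMap (PowerSeries k) D (PowerSeries.C a) =
      Ideal.Quotient.mk P (PowerSeries.C (Polynomial.C a)) := fun a => by
    change Ideal.Quotient.mk P (PowerSeries.map Polynomial.C (PowerSeries.C a)) = _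
    rw [PowerSeries.map_C]
  obtain ⟨φ, hφ, hφC, hφm⟩ := exists_ringHom_powerSeries_of_finite (RingHom.ker ε') (by
    rw [hXD, RingHom.mem_ker, Ideal.Quotient.lift_mk]
    simp [ε])
  refine ⟨φ.comp (Ideal.Quotient.mk P), ?_, fun a => ?_, ?_, ?_, ?_⟩
  · rw [RingHom.comp_apply, Ideal.Quotient.eq_zero_iff_mem.2 hFP, map_zero]
  · rw [RingHom.comp_apply, ← hCD, hφC]
  · rw [RingHom.comp_apply, map_ne_zero_iff φ hφ, Ne, Ideal.Quotient.eq_zero_iff_mem]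
    exact hXP
  · refine hφm _ ?_
    rw [RingHom.mem_ker, Ideal.Quotient.lift_mk]
    simp [ε]
  · have h := hφm (Ideal.Quotient.mk P (PowerSeries.C Polynomial.X) -
      Ideal.Quotient.mk P (PowerSeries.C (Polynomial.C c))) (by
        rw [RingHom.mem_ker, map_sub, Ideal.Quotient.lift_mk, Ideal.Quotient.lift_mk]
        simp [ε])
    rw [map_sub, ← hCD, hφC, map_sub, PowerSeries.constantCoeff_C, sub_eq_zero] at h
    exact h

end Parametrization

/-! ### Weighted substitutions and arcs -/

namespace PlaneSeries

/-- With two nonzero coefficients, `G` is not a monomial; after removing its power of `X`, a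
nonconstant factor not vanishing at `0` remains. -/
theorem exists_root_ne_zero {k : Type*} [Field k] [IsAlgClosed k] {G : Polynomial k} {a b : ℕ}
    (hab : a ≠ b) (ha : G.coeff a ≠ 0) (hb : G.coeff b ≠ 0) : ∃ c, c ≠ 0 ∧ G.eval c = 0 := by
  have hG : G ≠ 0 := by
    rintro rfl
    simp at ha
  obtain ⟨H, hH, hdvd⟩ := Polynomial.exists_eq_pow_rootMultiplicity_mul_and_not_dvd G hG 0
  rw [map_zero, sub_zero] at hH hdvd
  by_cases hdeg : H.degree = 0
  · exfalso
    rw [Polynomial.eq_C_of_degree_eq_zero hdeg, mul_comm] at hH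
    rw [hH, Polynomial.coeff_C_mul_X_pow] at ha hb
    simp only [ne_eq, ite_eq_right_iff, not_forall] at ha hb
    obtain ⟨rfl, -⟩ := ha
    obtain ⟨rfl, -⟩ := hb
    exact hab rfl
  · obtain ⟨c, hc⟩ := IsAlgClosed.exists_root H hdeg
    refine ⟨c, ?_, ?_⟩
    · rintro rfl
      exact hdvd (Polynomial.X_dvd_iff.2 ((Polynomial.coeff_zero_eq_eval_zero H).trans hc))
    · rw [hH, Polynomial.eval_mul, hc, mul_zero]

/-- The weight of an exponent. -/
def weight (w : Fin 2 → ℕ) (m : Fin 2 →₀ ℕ) : ℕ :=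
  w 0 * m 0 + w 1 * m 1

theorem eq_of_weight_eq {w : Fin 2 → ℕ} (hw : ∀ i, 0 < w i) {m m' : Fin 2 →₀ ℕ}
    (h : weight w m = weight w m') (h1 : m 1 = m' 1) : m = m' := by
  refine finsupp_fin_two_ext ?_ h1
  rw [weight, weight, h1] at h
  exact Nat.eq_of_mul_eq_mul_left (hw 0) (by omega)

section Toric

variable {k : Type*} [Field k] {w : Fin 2 → ℕ}

theorem hasSubst_toric (hw : ∀ i, 0 < w i) :
    MvPowerSeries.HasSubst (S := Polynomial k) (![PowerSeries.X ^ w 0,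
      PowerSeries.C Polynomial.X * PowerSeries.X ^ w 1] : Fin 2 → PowerSeries (Polynomial k)) :=
  MvPowerSeries.hasSubst_of_constantCoeff_zero fun i => by
    change PowerSeries.constantCoeff _ = 0
    fin_cases i
    · simp [(hw 0).ne']
    · simp [(hw 1).ne']

/-- The substitution `x = t ^ w 0`, `y = s * t ^ w 1`. -/
noncomputable def toric (hw : ∀ i, 0 < w i) :
    MvPowerSeries (Fin 2) k →+* PowerSeries (Polynomial k) :=
  (MvPowerSeries.substAlgHom (R := k) (hasSubst_toric hw)).toRingHom

theorem toric_X_zero (hw : ∀ i, 0 < w i) :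
    toric (k := k) hw (MvPowerSeries.X 0) = PowerSeries.X ^ w 0 :=
  (MvPowerSeries.substAlgHom_X (hasSubst_toric hw) 0).trans rfl

theorem toric_X_one (hw : ∀ i, 0 < w i) :
    toric (k := k) hw (MvPowerSeries.X 1) =
      PowerSeries.C Polynomial.X * PowerSeries.X ^ w 1 :=
  (MvPowerSeries.substAlgHom_X (hasSubst_toric hw) 1).trans rfl

theorem toric_algebraMap (hw : ∀ i, 0 < w i) (c : k) :
    toric hw (algebraMap k _ c) = PowerSeries.C (Polynomial.C c) := by
  refine ((MvPowerSeries.substAlgHom (R := k) (S := Polynomial k) (τ := Unit)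
    (hasSubst_toric hw)).commutes c).trans ?_
  rw [MvPowerSeries.algebraMap_apply]
  rfl

theorem coeff_toric (hw : ∀ i, 0 < w i) (f : MvPowerSeries (Fin 2) k) (n : ℕ) :
    PowerSeries.coeff n (toric hw f) = ∑ᶠ m : Fin 2 →₀ ℕ,
      if weight w m = n then Polynomial.monomial (m 1) (MvPowerSeries.coeff m f) else 0 := by
  have : toric hw f = MvPowerSeries.subst _ f :=
    congrFun (MvPowerSeries.coe_substAlgHom (hasSubst_toric hw)) f
  rw [this, coeff_subst_fin_two (hasSubst_toric hw)]
  refine finsum_congr fun m => ?_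
  have : (PowerSeries.X ^ w 0) ^ m 0 *
      (PowerSeries.C (Polynomial.X : Polynomial k) * PowerSeries.X ^ w 1) ^ m 1 =
      PowerSeries.C (Polynomial.X ^ m 1) * PowerSeries.X ^ weight w m := by
    rw [weight, mul_pow, pow_add, pow_mul, pow_mul, map_pow]
    ring
  simp only [Matrix.cons_val_zero, Matrix.cons_val_one]
  rw [this, PowerSeries.coeff_C_mul, PowerSeries.coeff_X_pow]
  by_cases h : weight w m = n
  · rw [if_pos h, if_pos h.symm, mul_one, Polynomial.smul_X_eq_monomial]
  · rw [if_neg h, if_neg (Ne.symm h), mul_zero, smul_zero]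

theorem finite_weight_eq (hw : ∀ i, 0 < w i) (n : ℕ) : {m | weight w m = n}.Finite := by
  refine Set.Finite.of_injOn (f := fun m : Fin 2 →₀ ℕ => m 1) (t := Set.Iic n) ?_ ?_
    (Set.finite_Iic n)
  · intro m (hm : weight w m = n)
    rw [Set.mem_Iic, ← hm, weight]
    have := Nat.le_mul_of_pos_left (m 1) (hw 1)
    change m 1 ≤ _
    omega
  · intro m hm m' hm' h
    exact eq_of_weight_eq hw (hm.trans hm'.symm) h

/-- Monomials of equal weight share their power of `t` but carry distinct powers of `s`, so nothing
cancels. -/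
theorem coeff_coeff_toric (hw : ∀ i, 0 < w i) (f : MvPowerSeries (Fin 2) k) (m : Fin 2 →₀ ℕ) :
    (PowerSeries.coeff (weight w m) (toric hw f)).coeff (m 1) = MvPowerSeries.coeff m f := by
  rw [coeff_toric, ← Polynomial.lcoeff_apply, ← LinearMap.toAddMonoidHom_coe,
    AddMonoidHom.map_finsum, finsum_eq_single _ m]
  · simp
  · intro m' hm'
    by_cases h : weight w m' = weight w m
    · have : m' 1 ≠ m 1 := fun h1 => hm' (eq_of_weight_eq hw h h1)
      simp [h, Polynomial.coeff_monomial, this]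
    · simp [h]
  · refine (finite_weight_eq hw (weight w m)).subset fun m' hm' => ?_
    by_contra hne
    exact hm' (if_neg hne)

variable [IsAlgClosed k] [CharZero k]

/-- If the minimal weight of the exponents of a series is attained twice, then its zero locus
contains an arc with proportional initial exponents. -/
theorem exists_arc (hw : ∀ i, 0 < w i) {f : MvPowerSeries (Fin 2) k} {m m' : Fin 2 →₀ ℕ}
    (hne : m ≠ m') (hm : MvPowerSeries.coeff m f ≠ 0) (hm' : MvPowerSeries.coeff m' f ≠ 0)
    (hmm' : weight w m = weight w m')
    (hmin : ∀ n, MvPowerSeries.coeff n f ≠ 0 → weight w m ≤ weight w n) :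
    ∃ γ : Fin 2 → PowerSeries k, (∀ i, PowerSeries.constantCoeff (γ i) = 0) ∧ (∀ i, γ i ≠ 0) ∧
      MvPowerSeries.subst γ f = 0 ∧ ∃ N : ℕ, 0 < N ∧ ∀ i, (γ i).order.toNat = N * w i := by
  obtain ⟨F, hF⟩ : PowerSeries.X ^ weight w m ∣ toric hw f := by
    rw [PowerSeries.X_pow_dvd_iff]
    intro n hn
    rw [coeff_toric]
    refine finsum_eq_zero_of_forall_eq_zero fun l => ?_
    split_ifs with hl
    · rw [Polynomial.monomial_eq_zero_iff]
      by_contra hne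
      exact absurd (hmin l hne) (by omega)
    · rfl
  have hF0 : PowerSeries.coeff (weight w m) (toric hw f) = PowerSeries.constantCoeff F := by
    have := PowerSeries.coeff_X_pow_mul F (weight w m) 0
    rwa [zero_add, ← hF, PowerSeries.coeff_zero_eq_constantCoeff_apply] at this
  have h1 : (PowerSeries.constantCoeff F).coeff (m 1) ≠ 0 := by
    rwa [← hF0, coeff_coeff_toric]
  have h2 : (PowerSeries.constantCoeff F).coeff (m' 1) ≠ 0 := by
    rwa [← hF0, hmm', coeff_coeff_toric]
  obtain ⟨c, hc, hroot⟩ := exists_root_ne_zero (fun h => hne (eq_of_weight_eq hw hmm' h)) h1 h2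
  obtain ⟨ψ, hψF, hψC, hψX, hψX0, hψs⟩ := exists_parametrization (fun h => h1 (by simp [h])) hroot
  let φ : MvPowerSeries (Fin 2) k →ₐ[k] PowerSeries k :=
    { ψ.comp (toric hw) with
      commutes' := fun a => (congrArg ψ (toric_algebraMap hw a)).trans (hψC a) }
  have hφ0 : φ (MvPowerSeries.X 0) = ψ PowerSeries.X ^ w 0 := by
    rw [← map_pow, ← toric_X_zero hw]
    rfl
  have hφ1 : φ (MvPowerSeries.X 1) = ψ (PowerSeries.C Polynomial.X) * ψ PowerSeries.X ^ w 1 := by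
    rw [← map_pow, ← map_mul, ← toric_X_one hw]
    rfl
  have hs0 : ψ (PowerSeries.C Polynomial.X) ≠ 0 := by
    intro h
    rw [h, map_zero] at hψs
    exact hc hψs.symm
  have hconst : ∀ i, PowerSeries.constantCoeff (φ (MvPowerSeries.X i)) = 0 := by
    rw [Fin.forall_fin_two, hφ0, hφ1]
    simp [hψX0, (hw 0).ne', (hw 1).ne']
  -- The image of `s` has constant term `c ≠ 0`, so it is a unit and does not affect the order of
  -- the second component.
  have hsord : (ψ (PowerSeries.C Polynomial.X)).order = 0 := by
    by_contra hne
    exact hc (hψs.symm.trans (PowerSeries.order_ne_zero_iff_constCoeff_eq_zero.1 hne))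
  refine ⟨fun i => φ (MvPowerSeries.X i), hconst, ?_, ?_, (ψ PowerSeries.X).order.toNat, ?_, ?_⟩
  · rw [Fin.forall_fin_two]
    beta_reduce
    rw [hφ0, hφ1]
    exact ⟨pow_ne_zero _ hψX, mul_ne_zero hs0 (pow_ne_zero _ hψX)⟩
  · rw [algHom_eq_subst φ hconst]
    change ψ (toric hw f) = 0
    rw [hF, map_mul, hψF, mul_zero]
  · rw [Nat.pos_iff_ne_zero, Ne, ENat.toNat_eq_zero, not_or]
    exact ⟨PowerSeries.order_ne_zero_iff_constCoeff_eq_zero.2 hψX0,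
      fun h => hψX (PowerSeries.order_eq_top.1 h)⟩
  · rw [Fin.forall_fin_two]
    beta_reduce
    rw [hφ0, hφ1, PowerSeries.order_mul, hsord, zero_add,
      PowerSeries.order_pow, PowerSeries.order_pow]
    simp [mul_comm]

end Toric

/-- The minimal weight of the exponents of a series is attained at least twice for the weight
given by the initial exponents of an arc contained in its zero locus. -/
theorem exists_ne_of_subst_eq_zero {k : Type*} [Field k] {γ : Fin 2 → PowerSeries k}
    (hconst : ∀ i, PowerSeries.constantCoeff (γ i) = 0) (hγ : ∀ i, γ i ≠ 0)
    {f : MvPowerSeries (Fin 2) k} (hf : MvPowerSeries.subst γ f = (0 : PowerSeries k))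
    {w : Fin 2 → ℕ} (hw : ∀ i, (γ i).order.toNat = w i)
    {m : Fin 2 →₀ ℕ} (hm : MvPowerSeries.coeff m f ≠ 0)
    (hmin : ∀ n, MvPowerSeries.coeff n f ≠ 0 → weight w m ≤ weight w n) :
    ∃ m', m' ≠ m ∧ MvPowerSeries.coeff m' f ≠ 0 ∧ weight w m' = weight w m := by
  by_contra! hcon
  have hs : MvPowerSeries.HasSubst (S := k) γ :=
    MvPowerSeries.hasSubst_of_constantCoeff_zero hconst
  have hu : ∀ i, PowerSeries.constantCoeff (γ i).divXPowOrder ≠ 0 := fun i =>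
    mt PowerSeries.constantCoeff_divXPowOrder_eq_zero_iff.1 (hγ i)
  have hprod : ∀ n : Fin 2 →₀ ℕ, γ 0 ^ n 0 * γ 1 ^ n 1 = PowerSeries.X ^ weight w n *
      ((γ 0).divXPowOrder ^ n 0 * (γ 1).divXPowOrder ^ n 1) := fun n => by
    conv_lhs => rw [← PowerSeries.X_pow_order_mul_divXPowOrder (f := γ 0),
      ← PowerSeries.X_pow_order_mul_divXPowOrder (f := γ 1), hw, hw]
    rw [weight, pow_add, pow_mul, pow_mul]
    ring
  have h0 := coeff_subst_fin_two hs f (weight w m)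
  -- If `m` were the only minimizer, its term alone would contribute to this coefficient, with a
  -- nonzero value.
  rw [hf, map_zero, finsum_eq_single _ m] at h0
  · have := PowerSeries.coeff_X_pow_mul
      ((γ 0).divXPowOrder ^ m 0 * (γ 1).divXPowOrder ^ m 1) (weight w m) 0
    rw [zero_add, PowerSeries.coeff_zero_eq_constantCoeff_apply] at this
    rw [hprod, this, map_mul, map_pow, map_pow, smul_eq_mul] at h0
    exact mul_ne_zero hm (mul_ne_zero (pow_ne_zero _ (hu 0)) (pow_ne_zero _ (hu 1))) h0.symm
  · intro n hn
    by_cases hn0 : MvPowerSeries.coeff n f = 0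
    · rw [hn0, zero_smul]
    · have hlt : weight w m < weight w n := lt_of_le_of_ne (hmin n hn0) (hcon n hn hn0).symm
      rw [hprod, PowerSeries.X_pow_dvd_iff.1 (dvd_mul_right _ _) _ hlt, smul_zero]

end PlaneSeries

/-! ### Faces of convex hulls -/

/-- A convex combination with positive weights of points where `l ≥ M` attains `M` only if both
points do. The set `hconv` encodes this as a convexity statement. -/
theorem sep_convexHull_eq_convexHull {E : Type*} [AddCommGroup E] [Module ℝ E] {T : Set E}
    (l : E →ₗ[ℝ] ℝ) {M : ℝ} (hT : ∀ x ∈ T, M ≤ l x) :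
    {x ∈ convexHull ℝ T | l x = M} = convexHull ℝ {x ∈ T | l x = M} := by
  apply subset_antisymm
  · have hconv : Convex ℝ {x | M ≤ l x ∧ (l x = M → x ∈ convexHull ℝ {x ∈ T | l x = M})} := by
      rintro x ⟨hx, hx'⟩ y ⟨hy, hy'⟩ a b ha hb hab
      have hl : l (a • x + b • y) = a * l x + b * l y := by simp
      have h1 : a * M ≤ a * l x := mul_le_mul_of_nonneg_left hx ha
      have h2 : b * M ≤ b * l y := mul_le_mul_of_nonneg_left hy hb
      have h3 : a * M + b * M = M := by rw [← add_mul, hab, one_mul]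
      refine ⟨?_, fun h => ?_⟩
      · rw [hl]
        linarith
      · rw [hl] at h
        rcases ha.eq_or_lt with rfl | ha
        · obtain rfl : b = 1 := by linarith
          simpa using hy' (by linarith)
        rcases hb.eq_or_lt with rfl | hb
        · obtain rfl : a = 1 := by linarith
          simpa using hx' (by linarith)
        exact convex_convexHull ℝ _ (hx' (mul_left_cancel₀ ha.ne' (by linarith)))
          (hy' (mul_left_cancel₀ hb.ne' (by linarith))) ha.le hb.le hab
    rintro x ⟨hx, hxM⟩
    have hsub : T ⊆ {x | M ≤ l x ∧ (l x = M → x ∈ convexHull ℝ {x ∈ T | l x = M})} :=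
      fun y hy => ⟨hT y hy, fun h => subset_convexHull ℝ _ ⟨hy, h⟩⟩
    exact (convexHull_min hsub hconv hx).2 hxM
  · refine convexHull_min (fun x hx => ⟨subset_convexHull ℝ T hx.1, hx.2⟩) ?_
    exact (convex_convexHull ℝ T).inter (convex_hyperplane l.isLinear M)

/-! ### Compact edges of Newton polygons -/

namespace NewtonPolygon

variable {f : MvPowerSeries (Fin 2) ℂ}

theorem dotProduct_fin_two (w v : Fin 2 → ℝ) : w ⬝ᵥ v = w 0 * v 0 + w 1 * v 1 := by
  simp [dotProduct, Fin.sum_univ_two]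

theorem seriesSupport_subset : seriesSupport f ⊆ newtonPolygon f := fun v hv =>
  subset_convexHull ℝ _ ⟨v, hv, 0, fun _ => le_rfl, add_zero v⟩

theorem add_mem {v q : Fin 2 → ℝ} (hv : v ∈ newtonPolygon f) (hq : ∀ i, 0 ≤ q i) :
    v + q ∈ newtonPolygon f := by
  refine convexHull_min (t := {x | x + q ∈ newtonPolygon f}) ?_
    ((convex_convexHull ℝ _).translate_preimage_left q) hv
  rintro _ ⟨s, hs, r, hr, rfl⟩
  exact subset_convexHull ℝ _ ⟨s, hs, r + q, fun i => add_nonneg (hr i) (hq i),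
    (add_assoc _ _ _).symm⟩

theorem le_dotProduct_of_mem_add {w : Fin 2 → ℝ} (hw : ∀ i, 0 < w i) {M : ℝ}
    (hM : ∀ v ∈ seriesSupport f, M ≤ w ⬝ᵥ v) :
    ∀ v ∈ seriesSupport f + {v : Fin 2 → ℝ | ∀ i, 0 ≤ v i}, M ≤ w ⬝ᵥ v := by
  rintro _ ⟨s, hs, q, hq, rfl⟩
  have h1 := hM s hs
  rw [dotProduct_add, dotProduct_fin_two w q]
  have := mul_nonneg (hw 0).le (hq 0)
  have := mul_nonneg (hw 1).le (hq 1)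
  linarith

theorem le_dotProduct {w : Fin 2 → ℝ} (hw : ∀ i, 0 < w i) {M : ℝ}
    (hM : ∀ v ∈ seriesSupport f, M ≤ w ⬝ᵥ v) : ∀ v ∈ newtonPolygon f, M ≤ w ⬝ᵥ v := fun _ hv =>
  convexHull_min (le_dotProduct_of_mem_add hw hM)
    (convex_halfSpace_ge (dotProductBilin ℝ ℝ w).isLinear M) hv

/-- The face of a Newton polygon in a positive direction is the convex hull of the exponents that
it contains. -/
theorem face_eq {w : Fin 2 → ℝ} (hw : ∀ i, 0 < w i) {M : ℝ}
    (hM : ∀ v ∈ seriesSupport f, M ≤ w ⬝ᵥ v) :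
    {v ∈ newtonPolygon f | w ⬝ᵥ v = M} = convexHull ℝ {v ∈ seriesSupport f | w ⬝ᵥ v = M} := by
  refine (sep_convexHull_eq_convexHull (dotProductBilin ℝ ℝ w)
    (le_dotProduct_of_mem_add hw hM)).trans ?_
  congr 1
  ext v
  constructor
  · rintro ⟨⟨s, hs, q, hq, rfl⟩, h⟩
    have h : w ⬝ᵥ (s + q) = M := h
    have hs' := hM s hs
    rw [dotProduct_add, dotProduct_fin_two w q] at h
    have h0 := mul_nonneg (hw 0).le (hq 0)
    have h1 := mul_nonneg (hw 1).le (hq 1)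
    have hq0 : q = 0 := by
      funext i
      fin_cases i
      · exact (mul_eq_zero.1 (show w 0 * q 0 = 0 by linarith)).resolve_left (hw 0).ne'
      · exact (mul_eq_zero.1 (show w 1 * q 1 = 0 by linarith)).resolve_left (hw 1).ne'
    subst hq0
    beta_reduce
    rw [add_zero]
    exact ⟨hs, by simpa using h⟩
  · rintro ⟨hs, h⟩
    exact ⟨⟨v, hs, 0, fun _ => le_rfl, add_zero v⟩, h⟩

theorem exists_eq_smul_of_dotProduct_eq_zero {w : Fin 2 → ℝ} (hw : ∀ i, 0 < w i) {d v : Fin 2 → ℝ}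
    (hd : d ≠ 0) (hwd : w ⬝ᵥ d = 0) (hwv : w ⬝ᵥ v = 0) : ∃ c : ℝ, c • d = v := by
  rw [dotProduct_fin_two] at hwd hwv
  have hw0 := (hw 0).ne'
  have hw1 := (hw 1).ne'
  have hd1 : d 1 ≠ 0 := by
    intro h
    refine hd (funext fun i => ?_)
    fin_cases i
    · simpa [h, hw0] using hwd
    · exact h
  refine ⟨v 1 / d 1, funext fun i => ?_⟩
  fin_cases i
  · have : w 0 * (v 1 * d 0) = w 0 * (v 0 * d 1) := by linear_combination v 1 * hwd - d 1 * hwv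
    have := mul_left_cancel₀ hw0 this
    simp only [Fin.zero_eta, Pi.smul_apply, smul_eq_mul]
    field_simp
    linarith
  · simp [hd1]

/-- The exponents in a face in a positive direction are minimal exponents. -/
theorem face_subset_image_minimal {w : Fin 2 → ℝ} (hw : ∀ i, 0 < w i) {M : ℝ}
    (hM : ∀ v ∈ seriesSupport f, M ≤ w ⬝ᵥ v) :
    {v ∈ seriesSupport f | w ⬝ᵥ v = M} ⊆ (fun (m : Fin 2 →₀ ℕ) i => (m i : ℝ)) ''
      {m | Minimal (fun m => MvPowerSeries.coeff m f ≠ 0) m} := by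
  rintro v ⟨⟨m, hm, hv⟩, hvM⟩
  obtain rfl : v = fun i => (m i : ℝ) := funext hv
  refine ⟨m, ⟨hm, fun n hn hnm => ?_⟩, rfl⟩
  have h := hM _ ⟨n, hn, fun _ => rfl⟩
  rw [dotProduct_fin_two] at h hvM
  have h0 : (n 0 : ℝ) ≤ m 0 := Nat.cast_le.2 (hnm 0)
  have h1 : (n 1 : ℝ) ≤ m 1 := Nat.cast_le.2 (hnm 1)
  have := hw 0
  have := hw 1
  rw [Finsupp.le_def, Fin.forall_fin_two]
  constructor
  · rw [← Nat.cast_le (α := ℝ)]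
    nlinarith
  · rw [← Nat.cast_le (α := ℝ)]
    nlinarith

/-- Dickson's lemma: antichains of exponents are finite. -/
theorem finite_minimal (f : MvPowerSeries (Fin 2) ℂ) :
    {m | Minimal (fun m => MvPowerSeries.coeff m f ≠ 0) m}.Finite :=
  (setOfPred_minimal_antichain _).finite_of_partiallyWellOrderedOn (Set.isPWO_of_wellQuasiOrderedLE _)

/-- The face is the hull of finitely many exponents, hence compact; it lies on a line and contains
two distinct points. -/
theorem isCompactEdge_of_face {w : Fin 2 → ℝ} (hw : ∀ i, 0 < w i) {M : ℝ}
    (hM : ∀ v ∈ seriesSupport f, M ≤ w ⬝ᵥ v) {a b : Fin 2 → ℝ} (hab : a ≠ b)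
    (ha : a ∈ seriesSupport f) (hb : b ∈ seriesSupport f) (haM : w ⬝ᵥ a = M) (hbM : w ⬝ᵥ b = M) :
    IsCompactEdge (newtonPolygon f) {v ∈ newtonPolygon f | w ⬝ᵥ v = M} where
  isExposed := by
    intro _
    refine ⟨-(dotProductBilin ℝ ℝ w).toContinuousLinearMap, Set.ext fun v => ?_⟩
    refine and_congr_right fun hv => ⟨fun h y hy => ?_, fun h => ?_⟩
    · exact neg_le_neg (show w ⬝ᵥ v ≤ w ⬝ᵥ y from h ▸ le_dotProduct hw hM y hy)
    · have : w ⬝ᵥ v ≤ w ⬝ᵥ a := neg_le_neg_iff.1 (h a (seriesSupport_subset ha))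
      exact le_antisymm (haM ▸ this) (le_dotProduct hw hM v hv)
  isCompact := by
    rw [face_eq hw hM]
    exact (((finite_minimal f).image _).subset (face_subset_image_minimal hw hM)).isCompact_convexHull
      ℝ
  finrank_eq := by
    have : vectorSpan ℝ {v ∈ newtonPolygon f | w ⬝ᵥ v = M} = Submodule.span ℝ {a - b} := by
      apply le_antisymm
      · refine Submodule.span_le.2 ?_
        rintro _ ⟨x, ⟨-, hx⟩, y, ⟨-, hy⟩, rfl⟩
        refine Submodule.mem_span_singleton.2 (exists_eq_smul_of_dotProduct_eq_zero hw
          (sub_ne_zero.2 hab) ?_ ?_)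
        · rw [dotProduct_sub, haM, hbM, sub_self]
        · beta_reduce
          rw [vsub_eq_sub, dotProduct_sub, hx, hy, sub_self]
      · rw [Submodule.span_singleton_le_iff_mem]
        exact vsub_mem_vectorSpan ℝ ⟨seriesSupport_subset ha, haM⟩ ⟨seriesSupport_subset hb, hbM⟩
    rw [this, finrank_span_singleton (sub_ne_zero.2 hab)]

theorem exists_face_of_isCompactEdge {E : Set (Fin 2 → ℝ)}
    (hE : IsCompactEdge (newtonPolygon f) E) :
    ∃ (w : Fin 2 → ℝ) (M : ℝ), (∀ i, 0 < w i) ∧ (∀ v ∈ seriesSupport f, M ≤ w ⬝ᵥ v) ∧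
      E = {v ∈ newtonPolygon f | w ⬝ᵥ v = M} ∧
      ({v ∈ seriesSupport f | w ⬝ᵥ v = M}).Nontrivial := by
  have hnt : ¬ E.Subsingleton := fun h => by
    have := hE.finrank_eq
    rw [vectorSpan_of_subsingleton ℝ h, finrank_bot] at this
    exact zero_ne_one this
  obtain ⟨x, hx⟩ : E.Nonempty := by
    rw [Set.nonempty_iff_ne_empty]
    rintro rfl
    exact hnt Set.subsingleton_empty
  obtain ⟨l, hl⟩ := hE.isExposed ⟨x, hx⟩
  have hxl := hx
  rw [hl] at hxl
  -- Exposed faces maximize `l`, hence the sign.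
  let w : Fin 2 → ℝ := fun i => -l (Pi.single i 1)
  have hlw : ∀ v, l v = -(w ⬝ᵥ v) := fun v => by
    have hv : v = v 0 • Pi.single 0 1 + v 1 • Pi.single 1 1 := by
      ext i
      fin_cases i <;> simp
    conv_lhs => rw [hv]
    rw [map_add, map_smul, map_smul, dotProduct_fin_two]
    simp only [w, smul_eq_mul]
    ring
  have hray : ∀ i, ∀ s : ℝ, 0 ≤ s → x + s • Pi.single i 1 ∈ newtonPolygon f := fun i s hs =>
    add_mem hxl.1 fun j => mul_nonneg hs (by
      rw [Pi.single_apply]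
      split_ifs <;> norm_num)
  have hw : ∀ i, 0 < w i := by
    intro i
    refine lt_of_le_of_ne ?_ fun h0 => ?_
    · have := hxl.2 _ (hray i 1 zero_le_one)
      rw [one_smul, map_add] at this
      simp only [w]
      linarith
    · have hmem : ∀ s : ℝ, 0 ≤ s → x + s • Pi.single i 1 ∈ E := fun s hs => by
        rw [hl]
        refine ⟨hray i s hs, fun y hy => ?_⟩
        have hi : l (Pi.single i 1) = 0 := neg_eq_zero.1 h0.symm
        rw [map_add, map_smul, hi, smul_zero, add_zero]
        exact hxl.2 y hy
      obtain ⟨R, hR⟩ := hE.isCompact.isBounded.exists_norm_le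
      have h1 := (norm_le_pi_norm _ i).trans
        (hR _ (hmem (|R| + |x i| + 1) (by positivity)))
      rw [Pi.add_apply, Pi.smul_apply, Pi.single_eq_same, smul_eq_mul, mul_one,
        Real.norm_eq_abs] at h1
      have h2 := le_abs_self (x i + (|R| + |x i| + 1))
      have h3 := neg_abs_le (x i)
      have h4 := le_abs_self R
      linarith
  have hM : ∀ v ∈ newtonPolygon f, w ⬝ᵥ x ≤ w ⬝ᵥ v := fun v hv => by
    have := hxl.2 v hv
    rw [hlw, hlw] at this
    linarith
  have hEw : E = {v ∈ newtonPolygon f | w ⬝ᵥ v = w ⬝ᵥ x} := by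
    rw [hl]
    refine Set.ext fun v => and_congr_right fun hv => ⟨fun h => ?_, fun h y hy => ?_⟩
    · have := h x hxl.1
      rw [hlw, hlw] at this
      exact le_antisymm (by linarith) (hM v hv)
    · rw [hlw, hlw, h]
      exact neg_le_neg (hM y hy)
  have hS : ∀ v ∈ seriesSupport f, w ⬝ᵥ x ≤ w ⬝ᵥ v := fun v hv => hM v (seriesSupport_subset hv)
  refine ⟨w, w ⬝ᵥ x, hw, hS, hEw, ?_⟩
  rw [← Set.not_subsingleton_iff]
  intro hsub
  apply hnt
  rw [hEw, face_eq hw hS]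
  rcases hsub.eq_empty_or_singleton with h | ⟨v, h⟩
  · rw [h, convexHull_empty]
    exact Set.subsingleton_empty
  · rw [h, convexHull_singleton]
    exact Set.subsingleton_singleton

/-- Each compact edge is the hull of a subset of the finite set of minimal exponents. -/
theorem finite_isCompactEdge (f : MvPowerSeries (Fin 2) ℂ) :
    {E | IsCompactEdge (newtonPolygon f) E}.Finite := by
  refine (((finite_minimal f).image fun m i => (m i : ℝ)).finite_subsets.image
    (convexHull ℝ)).subset fun E hE => ?_
  obtain ⟨w, M, hw, hM, rfl, -⟩ := exists_face_of_isCompactEdge hE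
  exact ⟨_, face_subset_image_minimal hw hM, (face_eq hw hM).symm⟩

theorem isClosed_orthogonalRay (E : Set (Fin 2 → ℝ)) : IsClosed (orthogonalRay E) := by
  refine IsClosed.inter ?_ ?_
  · change IsClosed {w : Fin 2 → ℝ | ∀ i, 0 ≤ w i}
    rw [Set.ofPred_forall]
    exact isClosed_iInter fun i => isClosed_le continuous_const (continuous_apply i)
  · change IsClosed {w : Fin 2 → ℝ | ∀ a ∈ E, ∀ b ∈ E, w ⬝ᵥ (a - b) = 0}
    simp only [Set.ofPred_forall]
    refine isClosed_iInter fun a => isClosed_iInter fun _ => isClosed_iInter fun b =>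
      isClosed_iInter fun _ => isClosed_eq ?_ continuous_const
    exact (dotProductBilin ℝ ℝ).flip (a - b) |>.continuous_of_finiteDimensional

theorem cast_weight (w : Fin 2 → ℕ) (m : Fin 2 →₀ ℕ) :
    (PlaneSeries.weight w m : ℝ) = (fun i => (w i : ℝ)) ⬝ᵥ (fun i => (m i : ℝ)) := by
  rw [PlaneSeries.weight, dotProduct_fin_two]
  push_cast
  rfl

/-- A direction orthogonal to a difference of exponents is proportional to an integral one. -/
theorem exists_nat_weight {w : Fin 2 → ℝ} (hw : ∀ i, 0 < w i) {m n : Fin 2 →₀ ℕ} (hmn : m ≠ n)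
    (h : w ⬝ᵥ (fun i => (m i : ℝ)) = w ⬝ᵥ (fun i => (n i : ℝ))) :
    ∃ (W : Fin 2 → ℕ) (c : ℝ), 0 < c ∧ (∀ i, 0 < W i) ∧ w = c • fun i => (W i : ℝ) := by
  rw [dotProduct_fin_two, dotProduct_fin_two] at h
  have hw0 := hw 0
  have hw1 := hw 1
  have h' : w 0 * ((m 0 : ℝ) - n 0) = w 1 * ((n 1 : ℝ) - m 1) := by linarith
  have habs := congrArg abs h'
  rw [abs_mul, abs_mul, abs_of_pos hw0, abs_of_pos hw1] at habs
  have h0 : m 0 ≠ n 0 := fun h0 => by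
    rw [h0, sub_self, mul_zero, eq_comm, mul_eq_zero, sub_eq_zero, Nat.cast_inj] at h'
    exact hmn (PlaneSeries.finsupp_fin_two_ext h0 (h'.resolve_left hw1.ne').symm)
  have h1 : n 1 ≠ m 1 := fun h1 => by
    rw [h1, sub_self, mul_zero, mul_eq_zero, sub_eq_zero, Nat.cast_inj] at h'
    exact h0 (h'.resolve_left hw0.ne')
  have hc0 : (((m 0 : ℤ) - n 0).natAbs : ℝ) = |(m 0 : ℝ) - n 0| := by
    rw [Nat.cast_natAbs]
    push_cast
    rfl
  have hc1 : (((n 1 : ℤ) - m 1).natAbs : ℝ) = |(n 1 : ℝ) - m 1| := by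
    rw [Nat.cast_natAbs]
    push_cast
    rfl
  have hpos1 : 0 < |(n 1 : ℝ) - m 1| := abs_pos.2 (sub_ne_zero.2 (Nat.cast_injective.ne h1))
  -- Rotating `m - n` by a right angle gives an integral normal; `w` is positive, so absolute values
  -- settle the signs.
  refine ⟨![((n 1 : ℤ) - m 1).natAbs, ((m 0 : ℤ) - n 0).natAbs], w 0 / |(n 1 : ℝ) - m 1|,
    by positivity, ?_, ?_⟩
  · rw [Fin.forall_fin_two]
    simp only [Matrix.cons_val_zero, Matrix.cons_val_one]
    omega
  · funext i
    fin_cases i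
    · simp [hc1, hpos1.ne']
    · simp only [Fin.mk_one, Pi.smul_apply, Matrix.cons_val_one, Matrix.cons_val_zero, smul_eq_mul,
        hc0]
      rw [div_mul_eq_mul_div, habs, mul_div_cancel_right₀ _ hpos1.ne']

end NewtonPolygon

/-! ### The tropicalization of a principal germ -/

open NewtonPolygon

theorem isArcIn_span_singleton {f : MvPowerSeries (Fin 2) ℂ} {γ : Fin 2 → PowerSeries ℂ}
    (h0 : ∀ i, PowerSeries.constantCoeff (γ i) = 0) (hf : MvPowerSeries.subst γ f = 0) :
    IsArcIn (Ideal.span {f}) γ where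
  constantCoeff_eq_zero := h0
  subst_eq_zero := by
    intro g hg
    obtain ⟨u, rfl⟩ := Ideal.mem_span_singleton'.1 hg
    have hs : MvPowerSeries.HasSubst (S := ℂ) γ :=
      MvPowerSeries.hasSubst_of_constantCoeff_zero h0
    rw [MvPowerSeries.subst_mul hs, hf, mul_zero]

theorem smul_weightVector_mem_iUnion {f : MvPowerSeries (Fin 2) ℂ} (hf : f ≠ 0)
    {γ : Fin 2 → PowerSeries ℂ} (hγ : IsArcIn (Ideal.span {f}) γ) (hγ0 : IsInteriorArc γ)
    {c : ℝ} (hc : 0 ≤ c) :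
    c • weightVector γ ∈ ⋃ E ∈ {E | IsCompactEdge (newtonPolygon f) E}, orthogonalRay E := by
  let W : Fin 2 → ℕ := fun i => (γ i).order.toNat
  have hW : ∀ i, 0 < W i := fun i => by
    rw [Nat.pos_iff_ne_zero, Ne, ENat.toNat_eq_zero, not_or]
    exact ⟨PowerSeries.order_ne_zero_iff_constCoeff_eq_zero.2 (hγ.constantCoeff_eq_zero i),
      fun h => hγ0 i (PowerSeries.order_eq_top.1 h)⟩
  have hne : {m | MvPowerSeries.coeff m f ≠ 0}.Nonempty := by
    by_contra! h
    refine hf (MvPowerSeries.ext fun m => ?_)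
    by_contra hm
    exact Set.eq_empty_iff_forall_notMem.1 h m hm
  obtain ⟨m, hm, hmin⟩ : ∃ m ∈ {m | MvPowerSeries.coeff m f ≠ 0},
      ∀ n, MvPowerSeries.coeff n f ≠ 0 → PlaneSeries.weight W m ≤ PlaneSeries.weight W n :=
    ⟨Function.argminOn (PlaneSeries.weight W) _ hne, Function.argminOn_mem _ _ hne,
      fun n hn => Function.argminOn_le (PlaneSeries.weight W) _ hn⟩
  obtain ⟨m', hm'm, hm', hmm'⟩ := PlaneSeries.exists_ne_of_subst_eq_zero hγ.constantCoeff_eq_zero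
    hγ0 (hγ.subst_eq_zero f (Ideal.mem_span_singleton_self f)) (w := W) (fun _ => rfl) hm hmin
  have hw : ∀ i, 0 < weightVector γ i := fun i => Nat.cast_pos.2 (hW i)
  have hedge := isCompactEdge_of_face hw (M := PlaneSeries.weight W m) (f := f)
    (a := fun i => (m' i : ℝ)) (b := fun i => (m i : ℝ)) (by
      rintro v ⟨n, hn, hv⟩
      obtain rfl : v = fun i => (n i : ℝ) := funext hv
      exact (Nat.cast_le.2 (hmin n hn)).trans (cast_weight W n).le)
    (fun h => hm'm (Finsupp.ext fun i => Nat.cast_injective (congrFun h i)))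
    ⟨m', hm', fun _ => rfl⟩ ⟨m, hm, fun _ => rfl⟩
    ((cast_weight W m').symm.trans (congrArg Nat.cast hmm')) (cast_weight W m).symm
  refine Set.mem_biUnion hedge ⟨fun i => mul_nonneg hc (hw i).le, ?_⟩
  rintro a ⟨-, ha⟩ b ⟨-, hb⟩
  rw [smul_dotProduct, dotProduct_sub, ha, hb, sub_self, smul_zero]

theorem orthogonalRay_subset_localTropicalization {f : MvPowerSeries (Fin 2) ℂ}
    {E : Set (Fin 2 → ℝ)} (hE : IsCompactEdge (newtonPolygon f) E) :
    orthogonalRay E ⊆ localTropicalization (Ideal.span {f}) := by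
  obtain ⟨w, M, hw, hM, rfl, _, ⟨⟨m, hm, hma⟩, haM⟩, _, ⟨⟨n, hn, hnb⟩, hbM⟩, hab⟩ :=
    exists_face_of_isCompactEdge hE
  obtain rfl := funext hma
  obtain rfl := funext hnb
  have hmn : m ≠ n := by
    rintro rfl
    exact hab rfl
  obtain ⟨W, c, hc, hW, rfl⟩ := exists_nat_weight hw hmn (haM.trans hbM.symm)
  have hcast : ∀ l : Fin 2 →₀ ℕ, (c • fun i => (W i : ℝ)) ⬝ᵥ (fun i => (l i : ℝ)) =
      c * PlaneSeries.weight W l := fun l => by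
    rw [smul_dotProduct, cast_weight, smul_eq_mul]
  have hmn' : PlaneSeries.weight W m = PlaneSeries.weight W n := by
    have := haM.trans hbM.symm
    rw [hcast, hcast] at this
    exact Nat.cast_injective (mul_left_cancel₀ hc.ne' this)
  obtain ⟨γ, h0, hγ, hsubst, N, hN, hord⟩ := PlaneSeries.exists_arc hW hmn hm hn hmn' (by
    intro l hl
    have := hM _ ⟨l, hl, fun _ => rfl⟩
    rw [← haM, hcast, hcast] at this
    exact Nat.cast_le.1 (le_of_mul_le_mul_left this hc))
  rintro v ⟨hv, hvE⟩
  have hvab := hvE _ ⟨seriesSupport_subset ⟨m, hm, fun _ => rfl⟩, haM⟩ _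
    ⟨seriesSupport_subset ⟨n, hn, fun _ => rfl⟩, hbM⟩
  refine subset_closure (Set.mem_biUnion (x := weightVector γ)
    ⟨γ, isArcIn_span_singleton h0 hsubst, hγ, rfl⟩ ?_)
  have hW0 : (0 : ℝ) < W 0 := Nat.cast_pos.2 (hW 0)
  have hW1 : (0 : ℝ) < W 1 := Nat.cast_pos.2 (hW 1)
  have hN' : (0 : ℝ) < N := Nat.cast_pos.2 hN
  -- Both `v` and `W` are orthogonal to `m - n`, hence proportional; the arc has weight `N • W`, and
  -- the first coordinate fixes the factor.
  refine ⟨v 0 / (N * W 0), div_nonneg (hv 0) (by positivity), ?_⟩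
  have hWab := congrArg (Nat.cast (R := ℝ)) hmn'
  rw [cast_weight, cast_weight, dotProduct_fin_two, dotProduct_fin_two] at hWab
  rw [dotProduct_fin_two] at hvab
  simp only [Pi.sub_apply] at hvab
  have hne : (m 1 : ℝ) - n 1 ≠ 0 := fun h => hmn (PlaneSeries.eq_of_weight_eq hW hmn'
    (Nat.cast_injective (sub_eq_zero.1 h)))
  have hcross : v 1 * W 0 = v 0 * W 1 :=
    mul_right_cancel₀ hne (by linear_combination W 0 * hvab - v 0 * hWab)
  funext i
  fin_cases i
  · simp only [weightVector, Pi.smul_apply, hord, smul_eq_mul, Fin.zero_eta]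
    push_cast
    field_simp
  · simp only [weightVector, Pi.smul_apply, hord, smul_eq_mul, Fin.mk_one]
    push_cast
    field_simp
    exact hcross

theorem localTropicalization_span_singleton {f : MvPowerSeries (Fin 2) ℂ} (hf : f ≠ 0) :
    localTropicalization (Ideal.span {f}) =
      ⋃ E ∈ {E | IsCompactEdge (newtonPolygon f) E}, orthogonalRay E := by
  apply subset_antisymm
  · refine closure_minimal ?_
      ((finite_isCompactEdge f).isClosed_biUnion fun E _ => isClosed_orthogonalRay E)
    refine Set.iUnion₂_subset ?_
    rintro _ ⟨γ, hγ, hγ0, rfl⟩ _ ⟨c, hc, rfl⟩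
    exact smul_weightVector_mem_iUnion hf hγ hγ0 hc
  · exact Set.iUnion₂_subset fun E hE => orthogonalRay_subset_localTropicalization hE

theorem corollary3p7 (I : Ideal (MvPowerSeries (Fin 2) ℂ))
    (hY : IsPlaneCurveSingularity I) (hax : NoBranchInAxes I) :
    ∃ N : Set (Fin 2 → ℝ), IsNewtonPolygonOf I N ∧
      localTropicalization I = ⋃ E ∈ {E | IsCompactEdge N E}, orthogonalRay E := by
  obtain ⟨f, rfl⟩ := PlaneSeries.exists_eq_span_singleton fun g hg =>
    hax.mem_of_X_mul_mem hY.isRadical 0 hg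
  have hf : f ≠ 0 := by
    rintro rfl
    exact hY.ne_bot (Ideal.span_singleton_eq_bot.2 rfl)
  exact ⟨newtonPolygon f, ⟨⟨f, rfl⟩, fun g hg => newtonPolygon_eq_of_span_eq hg.symm⟩,
    localTropicalization_span_singleton hf⟩
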